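/- Let $\mathbb F$ be a field and let $\Gamma=(\text{Gates},\text{Cogates},\text{Edges})$ be a finite connected bipartite graph (parallel edges are allowed) with $n$ edges, embedded in the plane. **Planar spanning tree order.** Walk around the boundary of each face of $\Gamma$ and join each pair of consecutive gates on this boundary by an arc inside the face, parallel to the part of the boundary (through one cogate) that lies between them. These arcs are the edges of the region graph $\Gamma'$, whose vertices are the gates. Take a spanning tree of $\Gamma'$ and thicken it. The boundary of the resulting region is a closed curve that crosses each edge of $\Gamma$ exactly once; orient it in one of the two possible ways, start anywhere, and label the $r$-th edge crossed by $r\in[n]=\{1,\dots,n\}$. Any such labelling is called a planar spanning tree order. **Tensors.** For each edge label $e\in[n]$ let $V^e$ be a two-dimensional $\mathbb F$-vector space with a fixed basis $v^e_0,v^e_1$ and let $\nu^e_0,\nu^e_1$ be the dual basis of the dual space $V^{e\vee}$. For a set $I\subseteq[n]$ of labels and $K\subseteq I$, let $|K\rangle_I=\bigotimes_{e\in I} v^e_{[e\in K]}$ and ${}_I\langle K|=\bigotimes_{e\in I}\nu^e_{[e\in K]}$, where $[e\in K]$ is $1$ if $e\in K$ and $0$ otherwise. For a matrix $\Xi$ over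 $\mathbb F$ with rows and columns labelled by $I$, let $\Xi_K$ be the submatrix with rows and columns in $K$, taken in increasing order of their labels. The Pfaffian $\operatorname{Pf}(M)$ of an $m\times m$ skew-symmetric matrix $M$ is $0$ if $m$ is odd, and if $m$ is even it is $$\sum_\sigma \operatorname{sign}(\sigma)\, M_{\sigma(1)\sigma(2)}M_{\sigma(3)\sigma(4)}\cdots M_{\sigma(m-1)\sigma(m)},$$ the sum over permutations $\sigma$ with $\sigma(2k-1)<\sigma(2k)$ for $1\le k\le m/2$ and $\sigma(1)<\sigma(3)<\cdots<\sigma(m-1)$; it is $1$ if $m=0$. Put $$\operatorname{sPf}(\Xi)=\sum_{K\subseteq I}\operatorname{Pf}(\Xi_K)\,|K\rangle_I,\qquad \operatorname{sPf}^\vee(\Xi)=\sum_{K\subseteq I}\operatorname{Pf}(\Xi_{I\setminus K})\;{}_I\langle K|.$$ For disjoint label sets $I_i$ with union $[n]$, the labelled tensor product of tensors with label sets $I_i$ is the multilinear operation that sends a family of basis tensors $|K_i\rangle_{I_i}$ to $|\bigcup_i K_i\rangle_{[n]}$ (and likewise for dual basis tensors). The direct sum $\bigoplus_i\Xi_i$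 of matrices with label sets $I_i$ is the $[n]\times[n]$ matrix whose entry at $(k,\ell)$ is the entry of $\Xi_i$ if $k,\ell\in I_i$ for some $i$, and $0$ if $k$ and $\ell$ lie in different label sets. **Theorem.** Let the edges of $\Gamma$ be labelled by a planar spanning tree order. For each gate $g$ let $I_g\subseteq[n]$ be the set of edges at $g$, and for each cogate $c$ let $J_c\subseteq[n]$ be the set of edges at $c$. 1. For all skew-symmetric matrices $\Xi_g$ over $\mathbb F$ with label sets $I_g$, one for each gate $g$, $$\bigotimes_g \operatorname{sPf}(\Xi_g)=\operatorname{sPf}\Bigl(\bigoplus_g\Xi_g\Bigr).$$ 2. With the same edge order, for all skew-symmetric matrices $\Theta_c$ over $\mathbb F$ with label sets $J_c$, one for each cogate $c$, $$\bigotimes_c \operatorname{sPf}^\vee(\Theta_c)=\operatorname{sPf}^\vee\Bigl(\bigoplus_c\Theta_c\Bigr).$$ -/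

import Mathlib

noncomputable section

/-! ## Plane bipartite graphs and spanning tree curves -/

/-- A finite bipartite multigraph `(Gates, Cogates, Edges)` with an embedding in an oriented closed
surface, given combinatorially by its rotation system: `rotGate e` is the edge that follows `e` in
the counterclockwise order around the gate of `e`, and `rotCogate e` the edge that follows `e` in
the counterclockwise order around the cogate of `e`. Each rotation is a cyclic order on
the set of all edges at the vertex. -/
structure EmbeddedBipartiteGraph (Gate Cogate Edge : Type*) where
  gate : Edge → Gate
  cogate : Edge → Cogate
  rotGate : Equiv.Perm Edge
  rotCogate : Equiv.Perm Edge
  sameCycle_rotGate : ∀ e f, rotGate.SameCycle e f ↔ gate e = gate f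
  sameCycle_rotCogate : ∀ e f, rotCogate.SameCycle e f ↔ cogate e = cogate f

namespace EmbeddedBipartiteGraph

variable {Gate Cogate Edge : Type*}

/-- The adjacency graph on all vertices (gates and cogates). -/
def toSimpleGraph (Γ : EmbeddedBipartiteGraph Gate Cogate Edge) : SimpleGraph (Gate ⊕ Cogate) :=
  SimpleGraph.fromRel fun x y => ∃ e, x = Sum.inl (Γ.gate e) ∧ y = Sum.inr (Γ.cogate e)

/-- Face tracing. Traverse `e` from its gate to its cogate with the face on the left; the boundary
of the face leaves the cogate along the edge that is clockwise next to `e`, arrives at a gate, and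
leaves that gate along the edge that is clockwise next there. Each face boundary traverses
each of its gate-to-cogate sides once, so the faces are the cycles of this permutation. -/
def facePerm (Γ : EmbeddedBipartiteGraph Gate Cogate Edge) : Equiv.Perm Edge :=
  Γ.rotGate⁻¹ * Γ.rotCogate⁻¹

open Classical in
/-- The number of faces of a connected embedded graph (an isolated vertex has one face). -/
def numFaces (Γ : EmbeddedBipartiteGraph Gate Cogate Edge) : ℕ :=
  if IsEmpty Edge then 1 else Nat.card (Quotient (Equiv.Perm.SameCycle.setoid Γ.facePerm))

/-- Connected and embedded in the sphere (equivalently, in the plane): Euler's formula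
`V + F = E + 2` holds. -/
def IsConnectedPlane (Γ : EmbeddedBipartiteGraph Gate Cogate Edge) : Prop :=
  Γ.toSimpleGraph.Connected ∧
    Nat.card Gate + Nat.card Cogate + Γ.numFaces = Nat.card Edge + 2

/-- The region graph on the gates, restricted to a set `T` of its edges. Around each face of
`Γ` the consecutive gates are joined into a cycle. Consecutive gates on the boundary of a face are
separated by a corner of a cogate, that is, by a pair `e`, `rotCogate e` of consecutive edges at a
cogate. So the edges of the region graph are indexed by the edges `e` of `Γ`:
the region edge `e` joins the gate of `e` to the gate of `rotCogate e`, and is drawn in the face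
containing the corner between these two edges, parallel to the boundary of that face. -/
def regionGraph (Γ : EmbeddedBipartiteGraph Gate Cogate Edge) (T : Finset Edge) :
    SimpleGraph Gate :=
  SimpleGraph.fromRel fun g h => ∃ e ∈ T, g = Γ.gate e ∧ h = Γ.gate (Γ.rotCogate e)

/-- The set `T` of region edges is a spanning tree of the region graph (a multigraph, whence the
count of edges: `T` contains no loop and no two parallel edges). -/
def IsSpanningTree (Γ : EmbeddedBipartiteGraph Gate Cogate Edge) (T : Finset Edge) : Prop :=
  (Γ.regionGraph T).Connected ∧ T.card + 1 = Nat.card Gate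

/-- What is met on the circle around a gate: in counterclockwise order, for each edge `e` at the
gate, the tail of the region edge `e` (which runs along the clockwise side of `e`), then `e` itself,
then the head of the region edge `rotCogate⁻¹ e` (which runs along the counterclockwise
side of `e`). -/
inductive Slot (Edge : Type*) where
  | tail (e : Edge)
  | cross (e : Edge)
  | head (e : Edge)

/-- The next slot counterclockwise on the circle around the same gate. -/
def ccw (Γ : EmbeddedBipartiteGraph Gate Cogate Edge) : Slot Edge → Slot Edge
  | .tail e => .cross e
  | .cross e => .head e
  | .head e => .tail (Γ.rotGate e)

open Classical in
/-- If the slot holds an end of a region edge in `T`, pass to its other end; otherwise stay. -/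
def follow (Γ : EmbeddedBipartiteGraph Gate Cogate Edge) (T : Finset Edge) :
    Slot Edge → Slot Edge
  | .tail e => if e ∈ T then .head (Γ.rotCogate e) else .tail e
  | .cross e => .cross e
  | .head e => if Γ.rotCogate.symm e ∈ T then .tail (Γ.rotCogate.symm e) else .head e

/-- One step along the boundary curve of the thickening of the tree `T`, with the thickened
tree on the left: walk along the tree edge in the current slot, if there is one, to its other
end, then go on counterclockwise around the gate reached. The curve crosses the edge `e` of `Γ` when
it is at the slot `cross e`. -/
def curveStep (Γ : EmbeddedBipartiteGraph Gate Cogate Edge) (T : Finset Edge)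
    (s : Slot Edge) : Slot Edge :=
  Γ.ccw (Γ.follow T s)

/-- After crossing `e`, the next edge of `Γ` that the curve crosses is `f`. -/
def NextCrossing (Γ : EmbeddedBipartiteGraph Gate Cogate Edge) (T : Finset Edge)
    (e f : Edge) : Prop :=
  ∃ k, 0 < k ∧ (Γ.curveStep T)^[k] (.cross e) = .cross f ∧
    ∀ j, 0 < j → j < k → ∀ d, (Γ.curveStep T)^[j] (.cross e) ≠ .cross d

/-- The edges of `Γ` are labelled by `0, …, n - 1`, and this labelling is a planar spanning tree
order: for some spanning tree `T` of the region graph, the closed curve bounding the thickened tree,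
with one of its two orientations, crosses the edges cyclically in the order `0, 1, …, n - 1`. -/
def IsSpanningTreeOrder {n : ℕ} (Γ : EmbeddedBipartiteGraph Gate Cogate (Fin n)) : Prop :=
  ∃ T : Finset (Fin n), Γ.IsSpanningTree T ∧
    ((∀ i, Γ.NextCrossing T i (finRotate n i)) ∨ (∀ i, Γ.NextCrossing T (finRotate n i) i))

end EmbeddedBipartiteGraph

/-! ## Pfaffians and labelled subPfaffian tensors -/

open scoped TensorProduct

/-- The Pfaffian of an `m × m` matrix: zero for odd `m`; for even `m` the sum over
permutations `σ` with `σ 0 < σ 1`, `σ 2 < σ 3`, … and `σ 0 < σ 2 < σ 4 < …`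
of `sign σ * ∏ k, M (σ (2 k)) (σ (2 k + 1))`. -/
def pfaffian {R : Type*} [CommRing R] {m : ℕ} (M : Matrix (Fin m) (Fin m) R) : R :=
  if Even m then
    ∑ σ : Equiv.Perm (Fin m) with
        (∀ i j : Fin m, Even i.val → (j.val = i.val + 1 ∨ j.val = i.val + 2) → σ i < σ j),
      ((Equiv.Perm.sign σ : ℤ) : R) *
        ∏ k : Fin (m / 2), M (σ ⟨2 * k.val, by omega⟩) (σ ⟨2 * k.val + 1, by omega⟩)
  else 0

/-- `Pf (Ξ_I)`: the Pfaffian of the submatrix with the rows and columns in `I`, taken in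
increasing order of their labels. -/
def subPfaffian {R ι : Type*} [CommRing R] [LinearOrder ι] (Ξ : Matrix ι ι R) (I : Finset ι) : R :=
  pfaffian (Ξ.submatrix (I.orderEmbOfFin rfl) (I.orderEmbOfFin rfl))

section Tensors

variable {F : Type*} [Field F] {ι : Type*} [Fintype ι] [LinearOrder ι]
  {V : ι → Type*} [∀ i, AddCommGroup (V i)] [∀ i, Module F (V i)]

/-- The basis tensor `|I⟩` of `⨂ V i`: the bit at label `i` is `1` if `i ∈ I`, and `0` otherwise. -/
def bitTensor (b : ∀ i, Module.Basis (Fin 2) F (V i)) (I : Finset ι) : ⨂[F] i, V i :=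
  PiTensorProduct.tprod F fun i => b i (if i ∈ I then 1 else 0)

/-- The gate tensor `sPf Ξ = ∑ I, Pf (Ξ_I) |I⟩`. -/
def sPf (b : ∀ i, Module.Basis (Fin 2) F (V i)) (Ξ : Matrix ι ι F) : ⨂[F] i, V i :=
  ∑ I : Finset ι, subPfaffian Ξ I • bitTensor b I

/-- The cogate tensor `sPf^∨ Θ = ∑ J, Pf (Θ_{Jᶜ}) ⟨J|`, in the tensor product of the dual
spaces with the dual bases. -/
def sPfDual (b : ∀ i, Module.Basis (Fin 2) F (V i)) (Θ : Matrix ι ι F) :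
    ⨂[F] i, Module.Dual F (V i) :=
  ∑ J : Finset ι, subPfaffian Θ Jᶜ • bitTensor (fun i => (b i).dualBasis) J

end Tensors

section Labelled

variable {F : Type*} [Field F] {E P : Type*} [Fintype E] [Fintype P] [DecidableEq P]

/-- The tensor product of labelled tensors `T p`, where the bits of `T p` are labelled by the
fibre of `v` over `p`: on basis tensors it merges the labelled bitstrings (a bitstring `x` on all
labels restricts to one on each fibre), and it is extended multilinearly. -/
def labelledTensor {V : E → Type*} [∀ e, AddCommGroup (V e)] [∀ e, Module F (V e)]
    (b : ∀ e, Module.Basis (Fin 2) F (V e)) (v : E → P)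
    (T : ∀ p, ⨂[F] e : {e // v e = p}, V e) : ⨂[F] e, V e :=
  open Classical in
  ∑ x : E → Fin 2,
    (∏ p, (Basis.piTensorProduct fun e : {e // v e = p} => b e).repr (T p) fun e => x e) •
      PiTensorProduct.tprod F fun e => b e (x e)

/-- The direct sum of labelled matrices `Ξ p`, whose rows and columns are labelled by the fibre of
`v` over `p`: an entry with both labels in the same fibre is the entry of that matrix, and the
other entries are zero. -/
def labelledDirectSum (v : E → P) (Ξ : ∀ p, Matrix {e // v e = p} {e // v e = p} F) :
    Matrix E E F :=
  Matrix.reindex (Equiv.sigmaFiberEquiv v) (Equiv.sigmaFiberEquiv v) (Matrix.blockDiagonal' Ξ)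

end Labelled

end

/-! Compared coefficient by coefficient, both identities say that the Pfaffian of a principal
submatrix of a block diagonal matrix is the product of the Pfaffians of its blocks. For interleaved
blocks this can fail by a sign. It holds when the partition of the labels into blocks is noncrossing
(`subPfaffian_eq_prod`). What remains is that the edges at the gates, and likewise those at the
cogates, form noncrossing partitions.

Geometrically, the curve has all gates on one side and all cogates on the other, and the stars of
the vertices on one side are disjoint. The proof replaces this topology by counting. Let `c` be the
cyclic permutation that sends each edge to the next one crossed, and write `c = α * β`, with `α` the
rotation at the gates or the inverse rotation at the cogates. If `α` and `β` together have at least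
`n + 1` cycles, the cycles of `α` are noncrossing (`isNoncrossing_of_card_le`). With G gates, C
cogates, F faces and a tree of G - 1 edges, the counts are at least G + (n - (G - 1)) for the gates
and C + (F + G - 1) for the cogates. The first is `n + 1`, and so is the second by Euler's formula.

The number of cycles enters as the dimension of the space of invariant rational functions, so each
lower bound is an injection or a kernel estimate. -/

/-! ## Expansion of Pfaffians -/

/-- The permutations that index the terms of the Pfaffian. -/
def IsPfaffianPerm {m : ℕ} (σ : Equiv.Perm (Fin m)) : Prop :=
  ∀ i j : Fin m, Even i.val → (j.val = i.val + 1 ∨ j.val = i.val + 2) → σ i < σ j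

/-- The permutation of `Fin (m + 2)` that fixes `0`, sends `1` to `j + 1`, and is `σ` after
deletion of these points. -/
def extendPerm {m : ℕ} (j : Fin (m + 1)) (σ : Equiv.Perm (Fin m)) : Equiv.Perm (Fin (m + 2)) :=
  Equiv.Perm.decomposeFin.symm (0, j.cycleRange.symm * Equiv.Perm.decomposeFin.symm (0, σ))

section extendPerm

variable {m : ℕ} (j : Fin (m + 1)) (σ : Equiv.Perm (Fin m))

@[simp] theorem extendPerm_zero : extendPerm j σ 0 = 0 := by
  simp [extendPerm]

@[simp] theorem extendPerm_one : extendPerm j σ 1 = j.succ := by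
  rw [extendPerm, ← Fin.succ_zero_eq_one, Equiv.Perm.decomposeFin_symm_apply_succ]
  simp

@[simp] theorem extendPerm_succ_succ (i : Fin m) :
    extendPerm j σ i.succ.succ = (j.succAbove (σ i)).succ := by
  rw [extendPerm, Equiv.Perm.decomposeFin_symm_apply_succ]
  simp

theorem sign_extendPerm :
    Equiv.Perm.sign (extendPerm j σ) = (-1) ^ (j : ℕ) * Equiv.Perm.sign σ := by
  simp [extendPerm, Equiv.Perm.sign_mul]

theorem isPfaffianPerm_extendPerm : IsPfaffianPerm (extendPerm j σ) ↔ IsPfaffianPerm σ := by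
  constructor
  · intro h a b ha hab
    have := h a.succ.succ b.succ.succ (by simpa [Nat.even_add_one] using ha)
      (by simp only [Fin.val_succ]; omega)
    simpa [Fin.succAbove_lt_succAbove_iff] using this
  · intro h a b ha hab
    induction a using Fin.cases with
    | zero =>
      have hb : extendPerm j σ b ≠ 0 := by
        rw [← extendPerm_zero j σ]
        intro h0
        rw [(extendPerm j σ).injective h0] at hab
        simp at hab
      rw [extendPerm_zero]
      exact Fin.pos_of_ne_zero hb
    | succ a =>
      induction a using Fin.cases with
      | zero => simp at ha
      | succ a =>
        induction b using Fin.cases with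
        | zero => simp at hab
        | succ b =>
          induction b using Fin.cases with
          | zero => simp at hab
          | succ b =>
            simp only [Fin.val_succ] at ha hab
            have := h a b (by simpa [Nat.even_add_one] using ha) (by omega)
            simpa [Fin.succAbove_lt_succAbove_iff] using this

end extendPerm

theorem extendPerm_injective {m : ℕ} :
    Function.Injective fun x : Fin (m + 1) × Equiv.Perm (Fin m) => extendPerm x.1 x.2 := by
  rintro ⟨j, σ⟩ ⟨k, τ⟩ h
  simp only at h
  obtain rfl : j = k := by simpa using congrArg (fun e : Equiv.Perm _ => e 1) h
  have : σ = τ := by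
    ext i
    have := congrArg (fun e : Equiv.Perm _ => e i.succ.succ) h
    simp only [extendPerm_succ_succ, Fin.succ_inj, Fin.succAbove_right_inj] at this
    rw [this]
  rw [this]

/-- A positive even position can be lowered by two, an odd one by one, and the value drops each
time. Every descent ends at position `0`, which therefore carries the least value. -/
theorem IsPfaffianPerm.apply_zero {m : ℕ} {σ : Equiv.Perm (Fin (m + 1))} (h : IsPfaffianPerm σ) :
    σ 0 = 0 := by
  have key : ∀ (k : ℕ) (hk : k < m + 1), σ 0 ≤ σ ⟨k, hk⟩ := by
    intro k
    induction k using Nat.strong_induction_on with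
    | _ k ih =>
      intro hk
      rcases Nat.eq_zero_or_pos k with rfl | hpos
      · exact le_rfl
      · rcases Nat.even_or_odd k with he | ho
        · obtain ⟨l, rfl⟩ := he
          exact (ih (l + l - 2) (by omega) (by omega)).trans
            (h ⟨l + l - 2, by omega⟩ ⟨l + l, hk⟩ (by exact ⟨l - 1, by simp; omega⟩)
              (by simp; omega)).le
        · obtain ⟨l, rfl⟩ := ho
          exact (ih (2 * l) (by omega) (by omega)).trans
            (h ⟨2 * l, by omega⟩ ⟨2 * l + 1, hk⟩ (by simp) (by simp)).le
  have := key (σ.symm 0) (σ.symm 0).isLt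
  simpa using this

theorem IsPfaffianPerm.exists_extendPerm {m : ℕ} {σ : Equiv.Perm (Fin (m + 2))}
    (h : IsPfaffianPerm σ) : ∃ x : Fin (m + 1) × Equiv.Perm (Fin m), extendPerm x.1 x.2 = σ := by
  have hbij : Function.Bijective fun x : Fin (m + 1) × Equiv.Perm (Fin m) =>
      (x.1.cycleRange.symm * Equiv.Perm.decomposeFin.symm (0, x.2) :
        Equiv.Perm (Fin (m + 1))) := by
    -- Injectivity suffices, since `(m + 1) * m! = (m + 1)!`.
    rw [Fintype.bijective_iff_injective_and_card]
    refine ⟨fun x y hxy => extendPerm_injective ?_, ?_⟩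
    · simp only [extendPerm]
      simp only at hxy
      rw [hxy]
    · simp [Fintype.card_perm, Nat.factorial_succ]
  obtain ⟨⟨p, e⟩, rfl⟩ := Equiv.Perm.decomposeFin.symm.surjective σ
  have hp : p = 0 := by simpa using h.apply_zero
  obtain ⟨x, hx⟩ := hbij.surjective e
  exact ⟨x, by rw [extendPerm, hp]; simp only at hx; rw [hx]⟩

theorem pfaffian_of_odd {R : Type*} [CommRing R] {m : ℕ} (M : Matrix (Fin m) (Fin m) R)
    (hm : ¬ Even m) : pfaffian M = 0 := by
  rw [pfaffian, if_neg hm]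

theorem pfaffian_zero {R : Type*} [CommRing R] (M : Matrix (Fin 0) (Fin 0) R) :
    pfaffian M = 1 := by
  simp [pfaffian]

/-- Expansion of the Pfaffian along the first row. -/
theorem pfaffian_succ_succ {R : Type*} [CommRing R] {m : ℕ}
    (M : Matrix (Fin (m + 2)) (Fin (m + 2)) R) :
    pfaffian M = ∑ j : Fin (m + 1), (-1) ^ (j : ℕ) * M 0 j.succ *
      pfaffian (M.submatrix (fun i => (j.succAbove i).succ) fun i => (j.succAbove i).succ) := by
  by_cases hm : Even m
  swap
  · rw [pfaffian_of_odd M (by simpa [Nat.even_add] using hm)]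
    simp [pfaffian_of_odd _ hm]
  have hm2 : Even (m + 2) := by simpa [Nat.even_add] using hm
  classical
  simp only [pfaffian, if_pos hm, if_pos hm2, Finset.mul_sum]
  rw [Finset.sum_sigma']
  symm
  refine Finset.sum_bij (fun x _ => extendPerm x.1 x.2) ?_ ?_ ?_ ?_
  · rintro ⟨j, σ⟩ h
    simp only [Finset.mem_sigma, Finset.mem_univ, Finset.mem_filter, true_and] at h ⊢
    exact (isPfaffianPerm_extendPerm j σ).2 h
  · rintro ⟨j, σ⟩ _ ⟨k, τ⟩ _ h
    have := @extendPerm_injective m (j, σ) (k, τ) h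
    simp only [Prod.mk.injEq] at this
    rw [this.1, this.2]
  · intro σ h
    simp only [Finset.mem_filter, Finset.mem_univ, true_and] at h
    obtain ⟨⟨j, τ⟩, rfl⟩ := IsPfaffianPerm.exists_extendPerm h
    refine ⟨⟨j, τ⟩, ?_, rfl⟩
    simp only [Finset.mem_sigma, Finset.mem_univ, Finset.mem_filter, true_and]
    exact (isPfaffianPerm_extendPerm j τ).1 h
  · rintro ⟨j, σ⟩ _
    have hdiv : (m + 2) / 2 = m / 2 + 1 := by omega
    rw [← Equiv.prod_comp (finCongr hdiv.symm), Fin.prod_univ_succ, sign_extendPerm]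
    have h0 : ∀ h, extendPerm j σ ⟨2 * 0, h⟩ = 0 := fun _ => extendPerm_zero j σ
    have h1 : ∀ h, extendPerm j σ ⟨2 * 0 + 1, h⟩ = j.succ := fun _ => extendPerm_one j σ
    have h2 : ∀ (k : Fin (m / 2)) h, extendPerm j σ ⟨2 * (k.val + 1), h⟩ =
        (j.succAbove (σ ⟨2 * k.val, by omega⟩)).succ := fun k _ =>
      extendPerm_succ_succ j σ ⟨2 * k.val, by omega⟩
    have h3 : ∀ (k : Fin (m / 2)) h, extendPerm j σ ⟨2 * (k.val + 1) + 1, h⟩ =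
        (j.succAbove (σ ⟨2 * k.val + 1, by omega⟩)).succ := fun k _ =>
      extendPerm_succ_succ j σ ⟨2 * k.val + 1, by omega⟩
    simp only [finCongr_apply, Fin.val_cast, Fin.val_zero, Fin.val_succ, h0, h1, h2, h3,
      Matrix.submatrix_apply]
    push_cast
    ring

/-! ## Pfaffians of submatrices -/

section subPfaffian

variable {R ι κ : Type*} [CommRing R] [LinearOrder ι] [LinearOrder κ]

theorem subPfaffian_eq_pfaffian (M : Matrix ι ι R) {I : Finset ι} {m : ℕ} {g : Fin m → ι}
    (hg : StrictMono g) (hI : Finset.univ.image g = I) :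
    subPfaffian M I = pfaffian (M.submatrix g g) := by
  subst hI
  have hcard : (Finset.univ.image g).card = m := by
    rw [Finset.card_image_of_injective _ hg.injective, Finset.card_univ, Fintype.card_fin]
  have key : ∀ (k : ℕ) (h : (Finset.univ.image g).card = k) (g' : Fin k → ι), StrictMono g' →
      (∀ i, g' i ∈ Finset.univ.image g) →
      subPfaffian M (Finset.univ.image g) = pfaffian (M.submatrix g' g') := by
    rintro k rfl g' hg' hmem
    rw [subPfaffian, ← Finset.orderEmbOfFin_unique rfl hmem hg']
  exact key m hcard g hg fun i => Finset.mem_image_of_mem _ (Finset.mem_univ i)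

theorem subPfaffian_empty (M : Matrix ι ι R) : subPfaffian M ∅ = 1 := by
  rw [subPfaffian_eq_pfaffian M (I := ∅) (g := Fin.elim0) (fun i => i.elim0) rfl, pfaffian_zero]

theorem subPfaffian_of_odd (M : Matrix ι ι R) {I : Finset ι} (hI : ¬ Even I.card) :
    subPfaffian M I = 0 :=
  pfaffian_of_odd _ hI

theorem subPfaffian_submatrix (M : Matrix ι ι R) {f : κ → ι} (hf : StrictMono f)
    (I : Finset κ) : subPfaffian (M.submatrix f f) I = subPfaffian M (I.image f) := by
  rw [subPfaffian_eq_pfaffian M (hf.comp (I.orderEmbOfFin rfl).strictMono)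
    (by rw [← Finset.image_image, Finset.image_orderEmbOfFin_univ])]
  rfl

/-- Expansion of a Pfaffian along the row of the least label. -/
theorem subPfaffian_insert_min (M : Matrix ι ι R) {a : ι} {I : Finset ι} (ha : ∀ i ∈ I, a < i) :
    subPfaffian M (insert a I) =
      ∑ j ∈ I, (-1) ^ (I.filter (· < j)).card * M a j * subPfaffian M (I.erase j) := by
  obtain ⟨m, hm⟩ : ∃ m, I.card = m := ⟨_, rfl⟩
  set g := I.orderEmbOfFin hm with hgdef
  have hgI : Finset.univ.image g = I := Finset.image_orderEmbOfFin_univ I hm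
  have hgmem : ∀ i, g i ∈ I := fun i => Finset.orderEmbOfFin_mem I hm i
  have hcons : StrictMono (Fin.cons a g : Fin (m + 1) → ι) := by
    intro i j hij
    induction j using Fin.cases with
    | zero => simp at hij
    | succ j =>
      induction i using Fin.cases with
      | zero => simpa using ha _ (hgmem j)
      | succ i => simpa using hij
  have himg : Finset.univ.image (Fin.cons a g : Fin (m + 1) → ι) = insert a I := by
    rw [← hgI]
    ext x
    simp [Fin.exists_fin_succ, eq_comm]
  rw [subPfaffian_eq_pfaffian M hcons himg]
  rcases m with _ | m
  · have : I = ∅ := Finset.card_eq_zero.1 hm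
    subst this
    rw [pfaffian_of_odd _ (by decide), Finset.sum_empty]
  rw [pfaffian_succ_succ]
  conv_rhs => rw [← hgI, Finset.sum_image fun _ _ _ _ h => g.injective h]
  refine Finset.sum_congr rfl fun j _ => ?_
  rw [hgI]
  congr 1
  · congr 2
    rw [← hgI, Finset.filter_image, Finset.card_image_of_injective _ g.injective]
    simp [Finset.filter_gt_eq_Iio]
  · rw [subPfaffian_eq_pfaffian M (g := fun i => g (j.succAbove i))
      (g.strictMono.comp (Fin.strictMono_succAbove j))]
    · rfl
    · ext x
      rw [← hgI]
      simp only [Finset.mem_image, Finset.mem_univ, true_and, Finset.mem_erase]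
      constructor
      · rintro ⟨i, rfl⟩
        exact ⟨fun h => Fin.succAbove_ne j i (g.injective h), _, rfl⟩
      · rintro ⟨hx, i, rfl⟩
        obtain ⟨k, rfl⟩ := Fin.exists_succAbove_eq (fun h : i = j => hx (by rw [h]))
        exact ⟨k, rfl⟩

end subPfaffian

/-! ## Pfaffians and noncrossing partitions -/

/-- The partition of a linear order into the fibres of `v` is noncrossing. -/
def IsNoncrossing {E P : Type*} [LinearOrder E] (v : E → P) : Prop :=
  ∀ ⦃a b c d : E⦄, a < b → b < c → c < d → v a = v c → v b = v d → v a = v b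

section Noncrossing

variable {R E P : Type*} [CommRing R] [LinearOrder E] [Fintype P] [DecidableEq P]

/-- Another block cannot have labels of `I` on both sides of `j`, for these would cross `a` and `j`.
Below `j` it thus contributes all of its labels in `I` or none, an even number in either case. -/
theorem IsNoncrossing.even_card_filter {v : E → P} (hv : IsNoncrossing v) {I : Finset E} {a j : E}
    (ha : ∀ i ∈ I, a < i) (hj : v j = v a)
    (heven : ∀ p, p ≠ v a → Even (I.filter (v · = p)).card) :
    Even ((I.filter (v · ≠ v a)).filter (· < j)).card := by
  rw [Finset.card_eq_sum_card_fiberwise (f := v) (t := Finset.univ) fun _ _ => Finset.mem_univ _]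
  refine Finset.even_sum _ fun p _ => ?_
  by_cases hp : p = v a
  · rw [Finset.filter_eq_empty_iff.2]
    · simp
    · intro x hx
      simp only [Finset.mem_filter] at hx
      rw [hp]
      exact hx.1.2
  by_cases h : ∃ x ∈ I, v x = p ∧ x < j
  · obtain ⟨x, hxI, hxp, hxj⟩ := h
    suffices hfib : (((I.filter (v · ≠ v a)).filter (· < j)).filter (v · = p)) =
        I.filter (v · = p) from hfib ▸ heven p hp
    ext y
    simp only [Finset.mem_filter]
    constructor
    · rintro ⟨⟨⟨h1, -⟩, -⟩, h2⟩
      exact ⟨h1, h2⟩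
    · rintro ⟨h1, h2⟩
      refine ⟨⟨⟨h1, by rwa [h2]⟩, ?_⟩, h2⟩
      by_contra hyj
      rcases eq_or_lt_of_le (not_lt.1 hyj) with rfl | hlt
      · exact hp (h2.symm.trans hj)
      · exact hp (hxp.symm.trans (hv (ha x hxI) hxj hlt hj.symm (hxp.trans h2.symm)).symm)
  · rw [Finset.filter_eq_empty_iff.2]
    · simp
    · intro x hx hxp
      simp only [Finset.mem_filter] at hx
      exact h ⟨x, hx.1.1, hxp, hx.2⟩

/-- The Pfaffian of a matrix that is block diagonal with respect to a noncrossing partition is the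
product of the Pfaffians of the blocks. -/
theorem subPfaffian_eq_prod {v : E → P} (hv : IsNoncrossing v) {M : Matrix E E R}
    (hM : ∀ i j, v i ≠ v j → M i j = 0) (K : Finset E) :
    subPfaffian M K = ∏ p, subPfaffian M (K.filter (v · = p)) := by
  induction hk : K.card using Nat.strong_induction_on generalizing K with
  | _ k ih =>
    rcases K.eq_empty_or_nonempty with rfl | hne
    · simp [subPfaffian_empty]
    obtain ⟨a, haK, hmin⟩ := K.exists_min_image id hne
    set I := K.erase a with hI
    have hKI : K = insert a I := (Finset.insert_erase haK).symm
    have ha : ∀ i ∈ I, a < i := fun i hi => lt_of_le_of_ne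
      (hmin i (Finset.mem_of_mem_erase hi)) (Finset.ne_of_mem_erase hi).symm
    have hIk : I.card < k := hk ▸ Finset.card_erase_lt_of_mem haK
    have haI : a ∉ I := Finset.notMem_erase a K
    clear_value I
    rw [← Finset.mul_prod_erase Finset.univ _ (Finset.mem_univ (v a))]
    have hother : ∏ p ∈ Finset.univ.erase (v a), subPfaffian M (K.filter (v · = p)) =
        ∏ p ∈ Finset.univ.erase (v a), subPfaffian M (I.filter (v · = p)) := by
      refine Finset.prod_congr rfl fun p hp => ?_
      rw [hKI, Finset.filter_insert, if_neg (Finset.ne_of_mem_erase hp).symm]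
    -- The label `a` is least in `K` and in its own block, so both sides expand along the same row;
    -- only columns in the block of `a` survive.
    rw [hother, hKI, Finset.filter_insert, if_pos rfl, subPfaffian_insert_min M ha,
      subPfaffian_insert_min M fun i hi => ha i (Finset.mem_of_mem_filter i hi),
      Finset.sum_filter, Finset.sum_mul]
    refine Finset.sum_congr rfl fun j hj => ?_
    by_cases hvj : v j = v a
    swap
    · rw [if_neg hvj, hM a j (Ne.symm hvj)]
      ring
    rw [if_pos hvj, ih _ ((Finset.card_erase_lt_of_mem hj).trans hIk) (I.erase j) rfl,
      ← Finset.mul_prod_erase Finset.univ _ (Finset.mem_univ (v a)), Finset.filter_erase,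
      Finset.prod_congr (g := fun p => subPfaffian M (I.filter (v · = p))) rfl]
    swap
    · intro p hp
      rw [Finset.filter_erase, Finset.erase_eq_of_notMem]
      simp only [Finset.mem_filter, not_and]
      exact fun _ h => Finset.ne_of_mem_erase hp (h ▸ hvj)
    -- If another block has odd size, its Pfaffian is zero and both terms vanish.
    by_cases heven : ∀ p, p ≠ v a → Even (I.filter (v · = p)).card
    swap
    · push Not at heven
      obtain ⟨p, hp, hodd⟩ := heven
      rw [Finset.prod_eq_zero (Finset.mem_erase.2 ⟨hp, Finset.mem_univ p⟩)
        (subPfaffian_of_odd M (by simpa using hodd))]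
      simp
    -- The exponents of the two signs differ by the number of labels below `j` outside the block of
    -- `a`, which is even.
    have hsplit := Finset.card_filter_add_card_filter_not (s := I.filter (· < j)) (v · = v a)
    rw [Finset.filter_comm, Finset.filter_comm (p := (· < j))] at hsplit
    rw [← hsplit, pow_add, (hv.even_card_filter ha hvj heven).neg_one_pow]
    ring

end Noncrossing

/-! ## Genus zero factorizations of a long cycle -/

/-- The functions that are constant on the cycles of a permutation. -/
def fixedFunctions {E : Type*} (α : Equiv.Perm E) : Submodule ℚ (E → ℚ) where
  carrier := {f | ∀ i, f (α i) = f i}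
  add_mem' hf hg i := by simp only [Pi.add_apply, hf i, hg i]
  zero_mem' _ := rfl
  smul_mem' c f hf i := by simp only [Pi.smul_apply, hf i]

theorem finrank_le_one_of_forall_eq {X : Type*} [Fintype X] {W : Submodule ℚ (X → ℚ)}
    (hW : ∀ f ∈ W, ∀ x y, f x = f y) : Module.finrank ℚ W ≤ 1 := by
  have hle : W ≤ Submodule.span ℚ {fun _ => 1} := by
    intro f hf
    rw [Submodule.mem_span_singleton]
    rcases isEmpty_or_nonempty X with hX | ⟨⟨x⟩⟩
    · exact ⟨0, Subsingleton.elim _ _⟩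
    · exact ⟨f x, funext fun y => by simpa using hW f hf x y⟩
  exact (Submodule.finrank_mono hle).trans ((finrank_span_le_card _).trans (by simp))

theorem card_le_finrank_fixedFunctions {E P : Type*} [Fintype E] [Fintype P] {α : Equiv.Perm E}
    {v : E → P} (hv : Function.Surjective v) (hα : ∀ i, v (α i) = v i) :
    Fintype.card P ≤ Module.finrank ℚ (fixedFunctions α) := by
  rw [← Module.finrank_fintype_fun_eq_card ℚ]
  refine LinearMap.finrank_le_finrank_of_injective
    (f := (LinearMap.funLeft ℚ ℚ v).codRestrict (fixedFunctions α) fun u i => ?_) ?_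
  · simp [LinearMap.funLeft_apply, hα]
  · intro u w h
    exact LinearMap.funLeft_injective_of_surjective ℚ ℚ v hv (congrArg Subtype.val h)

/-- A function invariant under `α` and `β` is invariant under `c`, hence constant. The intersection
has dimension at most one, and the dimension formula makes the sum everything. -/
theorem fixedFunctions_sup_eq_top {E : Type*} [Fintype E] {α β c : Equiv.Perm E}
    (hc : ∀ i, α (β i) = c i) (hconst : ∀ f ∈ fixedFunctions c, ∀ i j, f i = f j)
    (hcard : Fintype.card E + 1 ≤
      Module.finrank ℚ (fixedFunctions α) + Module.finrank ℚ (fixedFunctions β)) :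
    fixedFunctions α ⊔ fixedFunctions β = ⊤ := by
  have h1 := Submodule.finrank_sup_add_finrank_inf_eq (fixedFunctions α) (fixedFunctions β)
  have h2 : Module.finrank ℚ ↥(fixedFunctions α ⊓ fixedFunctions β) ≤ 1 :=
    finrank_le_one_of_forall_eq fun f hf => hconst f fun i => by
      rw [← hc, hf.1 (β i), hf.2 i]
  refine Submodule.eq_top_of_finrank_eq (le_antisymm (Submodule.finrank_le _) ?_)
  rw [Module.finrank_fintype_fun_eq_card]
  omega

/-- Split a function as `u + w` with `u` invariant under `α` and `w` under `β`. Since `u (β i) = u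
(c i)`, the hypothesis shows that composition with `β` preserves every sum over `S`. The indicator
of `S` then gives `β S = S`, so `α S = α (β S) = c S`. -/
theorem apply_mem_image_of_fixedFunctions_sup_eq_top {E : Type*} [DecidableEq E]
    {α β c : Equiv.Perm E} (hc : ∀ i, α (β i) = c i)
    (htop : fixedFunctions α ⊔ fixedFunctions β = ⊤) {S : Finset E}
    (hS : ∀ u ∈ fixedFunctions α, ∑ i ∈ S.image c, u i = ∑ i ∈ S, u i) {x : E} (hx : x ∈ S) :
    α x ∈ S.image c := by
  have hsum : ∀ f : E → ℚ, ∑ i ∈ S, f (β i) = ∑ i ∈ S, f i := by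
    intro f
    obtain ⟨u, hu, w, hw, rfl⟩ := Submodule.mem_sup.1 (htop ▸ Submodule.mem_top (x := f))
    have := hS u hu
    rw [Finset.sum_image fun _ _ _ _ h => c.injective h] at this
    simp only [Pi.add_apply, Finset.sum_add_distrib, hw _, ← this, ← hc, hu _]
  have hβ : ∀ i ∈ S, β i ∈ S := by
    have h := hsum fun i => if i ∈ S then 1 else 0
    rw [Finset.sum_boole, Finset.sum_boole, Nat.cast_inj, Finset.filter_mem_eq_inter,
      Finset.inter_self] at h
    intro i hi
    have := Finset.eq_of_subset_of_card_le (Finset.filter_subset (fun i => β i ∈ S) S) h.ge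
    rw [← this, Finset.mem_filter] at hi
    exact hi.2
  have himage : S.image β = S := Finset.eq_of_subset_of_card_le
    (Finset.image_subset_iff.2 hβ) (Finset.card_image_of_injective S β.injective).ge
  rw [← himage] at hx
  obtain ⟨y, hy, rfl⟩ := Finset.mem_image.1 hx
  rw [hc]
  exact Finset.mem_image_of_mem c hy

theorem image_finRotate_Ico {n : ℕ} {a c : Fin n} :
    (Finset.Ico a c).image (finRotate n) = Finset.Ioc a c := by
  rcases n with _ | n
  · exact a.elim0
  ext x
  simp only [Finset.mem_image, Finset.mem_Ico, Finset.mem_Ioc]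
  constructor
  · rintro ⟨i, ⟨h1, h2⟩, rfl⟩
    have hi : (finRotate (n + 1) i : ℕ) = i + 1 :=
      coe_finRotate_of_ne_last (h2.trans_le (Fin.le_last c)).ne
    rw [Fin.lt_def, Fin.le_def, hi]
    exact ⟨Nat.lt_succ_of_le h1, h2⟩
  · rintro ⟨h1, h2⟩
    rw [Fin.lt_def] at h1
    rw [Fin.le_def] at h2
    have hx : (x : ℕ) - 1 < n + 1 := by omega
    refine ⟨⟨x - 1, hx⟩, ⟨?_, ?_⟩, ?_⟩
    · rw [Fin.le_def]
      simp only
      omega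
    · rw [Fin.lt_def]
      simp only
      omega
    · have hne : (⟨x - 1, hx⟩ : Fin (n + 1)) ≠ Fin.last n := by
        rw [Ne, Fin.ext_iff, Fin.val_last]
        simp only
        omega
      rw [Fin.ext_iff, coe_finRotate_of_ne_last hne]
      simp only
      omega

theorem eq_of_mem_fixedFunctions_finRotate {n : ℕ} {f : Fin n → ℚ}
    (hf : f ∈ fixedFunctions (finRotate n)) (i j : Fin n) : f i = f j := by
  have key : ∀ (k : ℕ) (hk : k < n), f ⟨k, hk⟩ = f ⟨0, by omega⟩ := by
    intro k
    induction k with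
    | zero => exact fun _ => rfl
    | succ k ih =>
      intro hk
      rcases n with _ | n
      · omega
      rw [← ih (by omega), ← hf ⟨k, by omega⟩, finRotate_of_lt (by omega)]
  rw [key i i.isLt, key j j.isLt]

/-- If a long cycle on `n` letters is a product of two permutations with at least `n + 1` cycles in
total, then the cycles of the first one form a noncrossing partition. -/
theorem isNoncrossing_of_card_le {n : ℕ} {P : Type*} {α β c : Equiv.Perm (Fin n)}
    {v : Fin n → P} (hv : ∀ i j, α.SameCycle i j ↔ v i = v j) (hc : ∀ i, α (β i) = c i)
    (hrot : c = finRotate n ∨ c = (finRotate n)⁻¹)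
    (hcard : n + 1 ≤
      Module.finrank ℚ (fixedFunctions α) + Module.finrank ℚ (fixedFunctions β)) :
    IsNoncrossing v := by
  have htop := fixedFunctions_sup_eq_top (α := α) (β := β) hc (fun f hf i j => by
    rcases hrot with rfl | rfl
    · exact eq_of_mem_fixedFunctions_finRotate hf i j
    · refine eq_of_mem_fixedFunctions_finRotate (fun k => ?_) i j
      rw [← hf (finRotate n k), Equiv.Perm.inv_def, Equiv.symm_apply_apply]) (by simpa using hcard)
  intro x y z w hxy hyz hzw hxz hyw
  by_contra hne
  have hvα : ∀ i, v (α i) = v i := fun i => ((hv _ _).1 ⟨1, by simp⟩).symm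
  -- The rotation carries one of these half-open intervals to the other. They differ only in the
  -- endpoints, where `u` agrees because `x` and `z` lie in one cycle of `α`.
  have hsum : ∀ u ∈ fixedFunctions α,
      ∑ i ∈ Finset.Ioc x z, u i = ∑ i ∈ Finset.Ico x z, u i := by
    intro u hu
    have hu' : ∀ (k : ℕ) i, u ((α ^ k) i) = u i := by
      intro k
      induction k with
      | zero => simp
      | succ k ih =>
        intro i
        rw [pow_succ', Equiv.Perm.mul_apply, hu, ih]
    have huxz : u z = u x := by
      obtain ⟨k, -, hk⟩ := ((hv x z).2 hxz).exists_pow_eq'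
      rw [← hk, hu']
    have hlt := hxy.trans hyz
    rw [← Finset.Ioo_insert_right hlt, ← Finset.Ioo_insert_left hlt, Finset.sum_insert (by simp),
      Finset.sum_insert (by simp), huxz]
  have hstep : ∀ i, x < i → i < z → x ≤ α i ∧ α i ≤ z := by
    intro i hxi hiz
    rcases hrot with rfl | rfl
    · have := apply_mem_image_of_fixedFunctions_sup_eq_top hc htop (S := Finset.Ico x z)
        (by simpa only [image_finRotate_Ico] using hsum) (Finset.mem_Ico.2 ⟨hxi.le, hiz⟩)
      rw [image_finRotate_Ico, Finset.mem_Ioc] at this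
      exact ⟨this.1.le, this.2⟩
    · have himage : (Finset.Ioc x z).image ⇑(finRotate n)⁻¹ = Finset.Ico x z := by
        rw [← image_finRotate_Ico, Finset.image_image]
        have : ⇑(finRotate n)⁻¹ ∘ ⇑(finRotate n) = id :=
          funext fun k => (finRotate n).symm_apply_apply k
        rw [this, Finset.image_id]
      have := apply_mem_image_of_fixedFunctions_sup_eq_top hc htop (S := Finset.Ioc x z)
        (by simpa only [himage] using fun u hu => (hsum u hu).symm)
        (Finset.mem_Ioc.2 ⟨hxi, hiz.le⟩)
      rw [himage, Finset.mem_Ico] at this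
      exact ⟨this.1, this.2.le⟩
  -- The orbit of `y` avoids `x` and `z`, which lie in another cycle, so it is trapped strictly
  -- between them and cannot reach `w`.
  have horbit : ∀ k : ℕ, v ((α ^ k) y) = v y ∧ x < (α ^ k) y ∧ (α ^ k) y < z := by
    intro k
    induction k with
    | zero => exact ⟨rfl, hxy, hyz⟩
    | succ k ih =>
      obtain ⟨h1, h2, h3⟩ := ih
      rw [pow_succ', Equiv.Perm.mul_apply]
      have h4 : v (α ((α ^ k) y)) = v y := (hvα _).trans h1
      have h5 := hstep _ h2 h3
      refine ⟨h4, lt_of_le_of_ne h5.1 fun h => ?_, lt_of_le_of_ne h5.2 fun h => ?_⟩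
      · exact hne (by rw [← h4, ← h])
      · exact hne (by rw [← h4, h, hxz])
  obtain ⟨k, -, hk⟩ := ((hv y w).2 hyw).exists_pow_eq'
  have := (horbit k).2.2
  rw [hk] at this
  exact lt_asymm this hzw

/-! ## Spanning tree orders are noncrossing -/

namespace EmbeddedBipartiteGraph

variable {Gate Cogate Edge : Type*} (Γ : EmbeddedBipartiteGraph Gate Cogate Edge)

theorem gate_rotGate (e : Edge) : Γ.gate (Γ.rotGate e) = Γ.gate e :=
  ((Γ.sameCycle_rotGate _ _).1 ⟨1, by simp⟩).symm

theorem cogate_rotCogate (e : Edge) : Γ.cogate (Γ.rotCogate e) = Γ.cogate e :=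
  ((Γ.sameCycle_rotCogate _ _).1 ⟨1, by simp⟩).symm

variable {Γ}

theorem gate_surjective [Nonempty Edge] (h : Γ.toSimpleGraph.Connected) :
    Function.Surjective Γ.gate := by
  intro g
  obtain ⟨e⟩ := ‹Nonempty Edge›
  obtain ⟨w⟩ := h.preconnected (Sum.inl g) (Sum.inr (Γ.cogate e))
  cases w with
  | cons hadj _ =>
    obtain ⟨-, ⟨e, h1, -⟩ | ⟨e, -, h2⟩⟩ := (SimpleGraph.fromRel_adj _ _ _).1 hadj
    · exact ⟨e, (Sum.inl_injective h1).symm⟩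
    · simp at h2

theorem cogate_surjective [Nonempty Edge] (h : Γ.toSimpleGraph.Connected) :
    Function.Surjective Γ.cogate := by
  intro c
  obtain ⟨e⟩ := ‹Nonempty Edge›
  obtain ⟨w⟩ := h.preconnected (Sum.inr c) (Sum.inl (Γ.gate e))
  cases w with
  | cons hadj _ =>
    obtain ⟨-, ⟨e, h1, -⟩ | ⟨e, -, h2⟩⟩ := (SimpleGraph.fromRel_adj _ _ _).1 hadj
    · simp at h1
    · exact ⟨e, (Sum.inr_injective h2).symm⟩

theorem curveStep_tail (T : Finset Edge) (x : Edge) [Decidable (x ∈ T)] :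
    Γ.curveStep T (.tail x) =
      if x ∈ T then .tail (Γ.rotGate (Γ.rotCogate x)) else .cross x := by
  by_cases h : x ∈ T <;> simp [curveStep, follow, ccw, h]

/-- Each tree edge on the way moves the curve from the tail of `t` to the tail of `rotGate
(rotCogate t)`. The invariant `h` records where the run ends without naming its length. -/
theorem crossing_of_tail {X : Type*} {T : Finset Edge} {h : Edge → X}
    (hh : ∀ t ∈ T, h (Γ.rotGate (Γ.rotCogate t)) = h t) {f : Edge} (k : ℕ) (x : Edge)
    (hk : (Γ.curveStep T)^[k] (.tail x) = .cross f)
    (hlt : ∀ j < k, ∀ d, (Γ.curveStep T)^[j] (.tail x) ≠ .cross d) : f ∉ T ∧ h f = h x := by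
  classical
  induction k generalizing x with
  | zero => simp at hk
  | succ k ih =>
    rw [Function.iterate_succ_apply, curveStep_tail] at hk
    by_cases hx : x ∈ T
    · rw [if_pos hx] at hk
      rw [← hh x hx]
      refine ih _ hk fun j hj d => ?_
      have := hlt (j + 1) (by omega) d
      rwa [Function.iterate_succ_apply, curveStep_tail, if_pos hx] at this
    · rw [if_neg hx] at hk
      rcases k with _ | k
      · simp only [Function.iterate_zero, id_eq, Slot.cross.injEq] at hk
        exact hk ▸ ⟨hx, rfl⟩
      · refine absurd ?_ (hlt 1 (by omega) x)
        rw [Function.iterate_one, curveStep_tail, if_neg hx]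

/-- The curve crosses `e` and next `f`: if it runs back along a tree edge `t` after `e`, then
`f = t`, and otherwise `f` is found by running forwards along tree edges, starting with the edge
after `e` at the gate. -/
theorem NextCrossing.cases {T : Finset Edge} {e f : Edge} (hef : Γ.NextCrossing T e f) :
    (f ∈ T ∧ e = Γ.rotCogate f) ∨ ((∀ t ∈ T, e ≠ Γ.rotCogate t) ∧ f ∉ T ∧
      ∀ h : Edge → ℚ, (∀ t ∈ T, h (Γ.rotGate (Γ.rotCogate t)) = h t) →
        h f = h (Γ.rotGate e)) := by
  obtain ⟨k, hpos, hk, hlt⟩ := hef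
  have h1 : Γ.curveStep T (.cross e) = .head e := rfl
  -- The first slot after a crossing is a head, so the next crossing is at least two steps away.
  rcases k with _ | _ | k
  · omega
  · simp [h1] at hk
  rw [Function.iterate_succ_apply, Function.iterate_succ_apply, h1] at hk
  by_cases he : Γ.rotCogate.symm e ∈ T
  · have h2 : Γ.curveStep T (.head e) = .cross (Γ.rotCogate.symm e) := by
      simp [curveStep, follow, ccw, he]
    rw [h2] at hk
    rcases k with _ | k
    · simp only [Function.iterate_zero, id_eq, Slot.cross.injEq] at hk
      left
      rw [← hk]
      exact ⟨he, by simp⟩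
    · refine absurd ?_ (hlt 2 (by omega) (by omega) (Γ.rotCogate.symm e))
      rw [Function.iterate_succ_apply, Function.iterate_one, h1, h2]
  · have h2 : Γ.curveStep T (.head e) = .tail (Γ.rotGate e) := by
      simp [curveStep, follow, ccw, he]
    rw [h2] at hk
    have hlt' : ∀ j < k, ∀ d, (Γ.curveStep T)^[j] (.tail (Γ.rotGate e)) ≠ .cross d := by
      intro j hj d
      have := hlt (j + 2) (by omega) (by omega) d
      rwa [Function.iterate_succ_apply, Function.iterate_succ_apply, h1, h2] at this
    refine Or.inr ⟨fun t ht hte => he (by simpa [hte] using ht), ?_, fun h hh => ?_⟩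
    · exact (crossing_of_tail (h := fun _ => ()) (fun _ _ => rfl) k _ hk hlt').1
    · exact (crossing_of_tail hh k _ hk hlt').2

/-- Each tree edge imposes one linear equation on `h`, the invariance used in `NextCrossing.cases`.
For every solution `h`, the function `h ∘ rotGate` is invariant under `rotGate⁻¹ * c`. -/
theorem card_le_finrank_fixedFunctions_rotGate_inv_mul [Fintype Edge] {T : Finset Edge}
    {c : Equiv.Perm Edge} (hc : ∀ e, Γ.NextCrossing T e (c e)) :
    Fintype.card Edge ≤ T.card + Module.finrank ℚ (fixedFunctions (Γ.rotGate⁻¹ * c)) := by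
  let L : (Edge → ℚ) →ₗ[ℚ] (T → ℚ) :=
    LinearMap.funLeft ℚ ℚ (fun t : T => Γ.rotGate (Γ.rotCogate t)) -
      LinearMap.funLeft ℚ ℚ (fun t : T => (t : Edge))
  have hL := L.finrank_range_add_finrank_ker
  have hrange := Submodule.finrank_le (LinearMap.range L)
  rw [Module.finrank_fintype_fun_eq_card] at hL hrange
  rw [Fintype.card_coe] at hrange
  have hker : Module.finrank ℚ (LinearMap.ker L) ≤
      Module.finrank ℚ (fixedFunctions (Γ.rotGate⁻¹ * c)) := by
    refine LinearMap.finrank_le_finrank_of_injective (f := ((LinearMap.funLeft ℚ ℚ Γ.rotGate).comp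
      (LinearMap.ker L).subtype).codRestrict _ ?_) ?_
    · rintro ⟨h, hh⟩ e
      have hT : ∀ t ∈ T, h (Γ.rotGate (Γ.rotCogate t)) = h t := fun t ht =>
        sub_eq_zero.1 (congrFun (LinearMap.mem_ker.1 hh) ⟨t, ht⟩)
      simp only [LinearMap.comp_apply, LinearMap.funLeft_apply, Submodule.subtype_apply,
        Equiv.Perm.mul_apply, Equiv.Perm.inv_def, Equiv.apply_symm_apply]
      rcases (hc e).cases with ⟨h1, h2⟩ | ⟨-, -, h3⟩
      · conv_rhs => rw [h2, hT _ h1]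
      · exact h3 h hT
    · intro h h' hh
      exact Subtype.ext (LinearMap.funLeft_injective_of_surjective ℚ ℚ _ Γ.rotGate.surjective
        (congrArg Subtype.val hh))
  omega

/-- The coboundary map of the tree has only constants in its kernel, by connectedness; the number of
tree edges then forces surjectivity. -/
theorem IsSpanningTree.exists_sub_eq [Fintype Gate] {T : Finset Edge} (hT : Γ.IsSpanningTree T)
    (q : T → ℚ) :
    ∃ u : Gate → ℚ, ∀ t : T, u (Γ.gate (Γ.rotCogate t)) - u (Γ.gate t) = q t := by
  let D : (Gate → ℚ) →ₗ[ℚ] (T → ℚ) :=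
    LinearMap.funLeft ℚ ℚ (fun t : T => Γ.gate (Γ.rotCogate t)) -
      LinearMap.funLeft ℚ ℚ (fun t : T => Γ.gate t)
  have hker : Module.finrank ℚ (LinearMap.ker D) ≤ 1 := by
    refine finrank_le_one_of_forall_eq fun u hu x y => ?_
    have hD : ∀ t ∈ T, u (Γ.gate (Γ.rotCogate t)) = u (Γ.gate t) := fun t ht =>
      sub_eq_zero.1 (congrFun (LinearMap.mem_ker.1 hu) ⟨t, ht⟩)
    obtain ⟨w⟩ := hT.1.preconnected x y
    induction w with
    | nil => rfl
    | cons hadj _ ih =>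
      rw [← ih]
      obtain ⟨-, ⟨e, he, rfl, rfl⟩ | ⟨e, he, rfl, rfl⟩⟩ := (SimpleGraph.fromRel_adj _ _ _).1 hadj
      · exact (hD e he).symm
      · exact hD e he
  have hD := D.finrank_range_add_finrank_ker
  have hcard := hT.2
  rw [Module.finrank_fintype_fun_eq_card, ← Nat.card_eq_fintype_card] at hD
  have htop : LinearMap.range D = ⊤ := by
    refine Submodule.eq_top_of_finrank_eq (le_antisymm (Submodule.finrank_le _) ?_)
    rw [Module.finrank_fintype_fun_eq_card, Fintype.card_coe]
    omega
  obtain ⟨u, hu⟩ := LinearMap.range_eq_top.1 htop q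
  exact ⟨u, fun t => congrFun hu t⟩

/-- No face boundary runs along tree edges only. -/
theorem IsSpanningTree.eq_zero_of_support [Fintype Gate] [Fintype Edge] {T : Finset Edge}
    (hT : Γ.IsSpanningTree T) {p : Edge → ℚ} (hp : ∀ e, p (Γ.rotCogate (Γ.rotGate e)) = p e)
    (hsupp : ∀ e ∉ T, p (Γ.rotCogate e) = 0) : p = 0 := by
  -- The number `p (rotCogate e)` is the coefficient of the region edge `e` in the sum of the face
  -- boundaries weighted by `p`. This sum is a cycle, hence orthogonal to every coboundary. It is
  -- supported on the tree, where it equals the coboundary of `u`, so its sum of squares is zero.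
  obtain ⟨u, hu⟩ := hT.exists_sub_eq fun t => p (Γ.rotCogate t)
  have hsum : ∑ e, p (Γ.rotCogate e) * (u (Γ.gate (Γ.rotCogate e)) - u (Γ.gate e)) = 0 := by
    simp only [mul_sub, Finset.sum_sub_distrib]
    rw [Equiv.sum_comp Γ.rotCogate fun e => p e * u (Γ.gate e),
      ← Equiv.sum_comp Γ.rotGate fun e => p (Γ.rotCogate e) * u (Γ.gate e)]
    simp [hp, gate_rotGate]
  have hsq : ∑ e, p (Γ.rotCogate e) * p (Γ.rotCogate e) = 0 := by
    rw [← hsum]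
    refine Finset.sum_congr rfl fun e _ => ?_
    by_cases he : e ∈ T
    · rw [hu ⟨e, he⟩]
    · simp [hsupp e he]
  have hzero := (Finset.sum_eq_zero_iff_of_nonneg fun e _ => mul_self_nonneg _).1 hsq
  ext e
  simpa using hzero (Γ.rotCogate.symm e) (Finset.mem_univ _)

/-- After `rotCogate t` with `t ∈ T` the curve crosses `t`, so `rotCogate t` is a fixed point of
`rotCogate * c` and may carry any value. Elsewhere a function constant on faces is invariant. The
two families are independent because no nonzero combination of face boundaries is supported on the
tree. -/
theorem numFaces_add_card_le_finrank [Fintype Gate] [Fintype Edge] [Nonempty Edge]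
    {T : Finset Edge} (hT : Γ.IsSpanningTree T) {c : Equiv.Perm Edge}
    (hc : ∀ e, Γ.NextCrossing T e (c e)) :
    Γ.numFaces + T.card ≤ Module.finrank ℚ (fixedFunctions (Γ.rotCogate * c)) := by
  classical
  have hfaces : Γ.numFaces ≤ Module.finrank ℚ (fixedFunctions Γ.facePerm) := by
    rw [numFaces, if_neg (not_isEmpty_of_nonempty Edge), Nat.card_eq_fintype_card]
    exact card_le_finrank_fixedFunctions Quotient.mk_surjective fun e =>
      Quotient.sound (s := Equiv.Perm.SameCycle.setoid Γ.facePerm) ⟨-1, by simp⟩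
  have hface : ∀ p ∈ fixedFunctions Γ.facePerm, ∀ e, p (Γ.rotCogate (Γ.rotGate e)) = p e := by
    intro p hp e
    rw [← hp]
    simp [facePerm]
  let Φ : (fixedFunctions Γ.facePerm × (T → ℚ)) →ₗ[ℚ] (Edge → ℚ) :=
    (fixedFunctions Γ.facePerm).subtype.coprod
      (LinearMap.pi fun e => if h : Γ.rotCogate.symm e ∈ T then LinearMap.proj ⟨_, h⟩ else 0)
  have hΦ : ∀ x e, e ∉ T → Φ x (Γ.rotCogate e) = x.1.1 (Γ.rotCogate e) := by
    intro x e he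
    simp [Φ, he]
  have hΦT : ∀ x (t : T), Φ x (Γ.rotCogate t) = x.1.1 (Γ.rotCogate t) + x.2 t := by
    intro x t
    simp [Φ]
  have hmem : ∀ x, Φ x ∈ fixedFunctions (Γ.rotCogate * c) := by
    intro x e
    rw [Equiv.Perm.mul_apply]
    rcases (hc e).cases with ⟨-, h2⟩ | ⟨h1, h2, h3⟩
    · rw [← h2]
    · have he : Γ.rotCogate.symm e ∉ T := fun h => h1 _ h (by simp)
      have hΦe := hΦ x _ he
      rw [Equiv.apply_symm_apply] at hΦe
      rw [hΦ x _ h2, hΦe, ← hface _ x.1.2 e]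
      exact h3 (fun e => x.1.1 (Γ.rotCogate e)) fun t _ => hface _ x.1.2 _
  have hinj : Function.Injective (Φ.codRestrict _ hmem) := by
    rw [injective_iff_map_eq_zero]
    intro x hx
    have hx0 : ∀ e, Φ x e = 0 := fun e => congrFun (congrArg Subtype.val hx) e
    have h1 : x.1.1 = 0 := hT.eq_zero_of_support (hface _ x.1.2) fun e he => by
      rw [← hΦ x e he, hx0]
    refine Prod.ext (Subtype.ext h1) (funext fun t => ?_)
    have := hΦT x t
    rw [hx0, h1] at this
    simpa using this.symm
  have := LinearMap.finrank_le_finrank_of_injective hinj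
  rw [Module.finrank_prod, Module.finrank_fintype_fun_eq_card, Fintype.card_coe] at this
  omega

variable {n : ℕ} {Γ : EmbeddedBipartiteGraph Gate Cogate (Fin n)}

theorem IsSpanningTreeOrder.exists_perm (h : Γ.IsSpanningTreeOrder) :
    ∃ (T : Finset (Fin n)) (c : Equiv.Perm (Fin n)), Γ.IsSpanningTree T ∧
      (c = finRotate n ∨ c = (finRotate n)⁻¹) ∧ ∀ e, Γ.NextCrossing T e (c e) := by
  obtain ⟨T, hT, hrot | hrot⟩ := h
  · exact ⟨T, _, hT, Or.inl rfl, hrot⟩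
  · exact ⟨T, _, hT, Or.inr rfl, fun e => by
      have := hrot ((finRotate n)⁻¹ e)
      rwa [Equiv.Perm.inv_def, Equiv.apply_symm_apply] at this⟩

theorem IsSpanningTreeOrder.isNoncrossing_gate [Fintype Gate] (hplane : Γ.IsConnectedPlane)
    (h : Γ.IsSpanningTreeOrder) : IsNoncrossing Γ.gate := by
  rcases isEmpty_or_nonempty (Fin n) with hn | hn
  · exact fun a => isEmptyElim a
  obtain ⟨T, c, hT, hrot, hc⟩ := h.exists_perm
  refine isNoncrossing_of_card_le Γ.sameCycle_rotGate (β := Γ.rotGate⁻¹ * c) (by simp) hrot ?_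
  have h1 := card_le_finrank_fixedFunctions (gate_surjective hplane.1) Γ.gate_rotGate
  have h2 := card_le_finrank_fixedFunctions_rotGate_inv_mul hc
  have h3 := hT.2
  rw [Nat.card_eq_fintype_card] at h3
  rw [Fintype.card_fin] at h2
  omega

theorem IsSpanningTreeOrder.isNoncrossing_cogate [Fintype Gate] [Fintype Cogate]
    (hplane : Γ.IsConnectedPlane) (h : Γ.IsSpanningTreeOrder) : IsNoncrossing Γ.cogate := by
  rcases isEmpty_or_nonempty (Fin n) with hn | hn
  · exact fun a => isEmptyElim a
  obtain ⟨T, c, hT, hrot, hc⟩ := h.exists_perm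
  -- With the tree on its left, the curve runs counterclockwise around gates and clockwise around
  -- cogates, whence the inverse.
  refine isNoncrossing_of_card_le (α := Γ.rotCogate⁻¹) (β := Γ.rotCogate * c)
    (fun i j => Equiv.Perm.sameCycle_inv.trans (Γ.sameCycle_rotCogate i j)) (by simp) hrot ?_
  have h1 := card_le_finrank_fixedFunctions (α := Γ.rotCogate⁻¹) (cogate_surjective hplane.1)
    fun e => by simpa using (Γ.cogate_rotCogate (Γ.rotCogate⁻¹ e)).symm
  have h2 := numFaces_add_card_le_finrank hT hc
  have h3 := hT.2
  have h4 := hplane.2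
  rw [Nat.card_eq_fintype_card] at h3
  simp only [Nat.card_eq_fintype_card, Fintype.card_fin] at h4
  omega

end EmbeddedBipartiteGraph

/-! ## Tensors in coordinates -/

theorem repr_bitTensor {F : Type*} [Field F] {ι : Type*} [Fintype ι] [LinearOrder ι]
    {V : ι → Type*} [∀ i, AddCommGroup (V i)] [∀ i, Module F (V i)]
    (b : ∀ i, Module.Basis (Fin 2) F (V i)) (I : Finset ι) (y : ι → Fin 2) :
    (Basis.piTensorProduct b).repr (bitTensor b I) y =
      if Finset.univ.filter (fun i => y i = 1) = I then 1 else 0 := by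
  rw [bitTensor, ← Basis.piTensorProduct_apply, Module.Basis.repr_self, Finsupp.single_apply]
  congr 1
  rw [eq_iff_iff]
  constructor
  · rintro rfl
    ext i
    simp
  · rintro rfl
    ext i
    have := (y i).isLt
    by_cases h : y i = 1
    · simp [h]
    · simp only [Finset.mem_filter, Finset.mem_univ, true_and, if_neg h, Fin.val_zero]
      rw [Fin.ext_iff, Fin.val_one] at h
      omega

theorem repr_sum_bitTensor {F : Type*} [Field F] {ι : Type*} [Fintype ι] [LinearOrder ι]
    {V : ι → Type*} [∀ i, AddCommGroup (V i)] [∀ i, Module F (V i)]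
    (b : ∀ i, Module.Basis (Fin 2) F (V i)) (a : Finset ι → F) (y : ι → Fin 2) :
    (Basis.piTensorProduct b).repr (∑ I, a I • bitTensor b I) y =
      a (Finset.univ.filter fun i => y i = 1) := by
  simp [Finsupp.finsetSum_apply, repr_bitTensor]

/-- The tensor product of labelled tensors whose coefficients multiply to those of a tensor on all
labels. -/
theorem labelledTensor_sum_bitTensor {F : Type*} [Field F] {n : ℕ} {P : Type*}
    [Fintype P] [DecidableEq P] {V : Fin n → Type*} [∀ e, AddCommGroup (V e)]
    [∀ e, Module F (V e)] (b : ∀ e, Module.Basis (Fin 2) F (V e)) (v : Fin n → P)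
    (a : ∀ p, Finset {e // v e = p} → F) (A : Finset (Fin n) → F)
    (h : ∀ K : Finset (Fin n), ∏ p, a p (K.subtype fun e => v e = p) = A K) :
    labelledTensor b v (fun p => ∑ I : Finset {e // v e = p},
      a p I • bitTensor (fun e : {e // v e = p} => b e) I) =
      ∑ K, A K • bitTensor b K := by
  apply (Basis.piTensorProduct b).ext_elem
  intro y
  rw [repr_sum_bitTensor, ← h, labelledTensor]
  simp only [repr_sum_bitTensor]
  simp only [← Basis.piTensorProduct_apply, map_sum, map_smul,
    Module.Basis.repr_self, Finsupp.finsetSum_apply, Finsupp.smul_single, smul_eq_mul, mul_one]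
  rw [Finset.sum_eq_single y (fun x _ hx => Finsupp.single_eq_of_ne hx.symm) (by simp),
    Finsupp.single_eq_same]
  refine Finset.prod_congr rfl fun p _ => ?_
  congr 1
  ext e
  simp

/-! ### Block Pfaffians inside the direct sum -/

section directSum

variable {F E P : Type*} [Field F] [DecidableEq P]

theorem labelledDirectSum_apply_coe (v : E → P)
    (Ξ : ∀ p, Matrix {e // v e = p} {e // v e = p} F) (p : P) (i j : {e // v e = p}) :
    labelledDirectSum v Ξ i j = Ξ p i j := by
  obtain ⟨i, rfl⟩ := i
  obtain ⟨j, hj⟩ := j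
  have hj' : (Equiv.sigmaFiberEquiv v).symm j = ⟨v i, j, hj⟩ := by
    rw [Equiv.symm_apply_eq]
    rfl
  rw [labelledDirectSum, Matrix.reindex_apply, Matrix.submatrix_apply, hj']
  exact Matrix.blockDiagonal'_apply_eq Ξ (v i) ⟨i, rfl⟩ ⟨j, hj⟩

theorem labelledDirectSum_apply_of_ne (v : E → P)
    (Ξ : ∀ p, Matrix {e // v e = p} {e // v e = p} F) (i j : E) (h : v i ≠ v j) :
    labelledDirectSum v Ξ i j = 0 :=
  Matrix.blockDiagonal'_apply_ne Ξ _ _ h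

theorem prod_subPfaffian_subtype [Fintype E] [LinearOrder E] [Fintype P] {v : E → P} (hv : IsNoncrossing v)
    (Ξ : ∀ p, Matrix {e // v e = p} {e // v e = p} F) (K : Finset E) :
    ∏ p, subPfaffian (Ξ p) (K.subtype fun e => v e = p) =
      subPfaffian (labelledDirectSum v Ξ) K := by
  rw [subPfaffian_eq_prod hv (labelledDirectSum_apply_of_ne v Ξ)]
  refine Finset.prod_congr rfl fun p _ => ?_
  have hΞ : Ξ p = (labelledDirectSum v Ξ).submatrix Subtype.val Subtype.val := by
    ext i j
    exact (labelledDirectSum_apply_coe v Ξ p i j).symm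
  rw [hΞ, subPfaffian_submatrix _ (Subtype.strictMono_coe _), ← Finset.subtype_map,
    Finset.map_eq_image]
  rfl

end directSum

/-! ### The two tensor identities -/

theorem mainTheorem1 {F : Type*} [Field F] {n : ℕ} {Gate Cogate : Type*}
    [Fintype Gate] [DecidableEq Gate] [Fintype Cogate] [DecidableEq Cogate]
    (Γ : EmbeddedBipartiteGraph Gate Cogate (Fin n))
    (hplane : Γ.IsConnectedPlane) (horder : Γ.IsSpanningTreeOrder)
    (V : Fin n → Type*) [∀ e, AddCommGroup (V e)] [∀ e, Module F (V e)]
    (b : ∀ e, Module.Basis (Fin 2) F (V e)) :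
    (∀ Ξ : ∀ g, Matrix {e // Γ.gate e = g} {e // Γ.gate e = g} F,
      (∀ g, (Ξ g).transpose = -Ξ g) →
        labelledTensor b Γ.gate (fun g => sPf (fun e => b e) (Ξ g)) =
          sPf b (labelledDirectSum Γ.gate Ξ)) ∧
    (∀ Θ : ∀ c, Matrix {e // Γ.cogate e = c} {e // Γ.cogate e = c} F,
      (∀ c, (Θ c).transpose = -Θ c) →
        labelledTensor (fun e => (b e).dualBasis) Γ.cogate
            (fun c => sPfDual (fun e => b e) (Θ c)) =
          sPfDual b (labelledDirectSum Γ.cogate Θ)) := by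
  refine ⟨fun Ξ _ => ?_, fun Θ _ => ?_⟩
  · exact labelledTensor_sum_bitTensor b Γ.gate (fun g => subPfaffian (Ξ g)) _
      (prod_subPfaffian_subtype (horder.isNoncrossing_gate hplane) Ξ)
  · refine labelledTensor_sum_bitTensor (fun e => (b e).dualBasis) Γ.cogate
      (fun c I => subPfaffian (Θ c) Iᶜ) (fun K => subPfaffian _ Kᶜ) fun K => ?_
    rw [← prod_subPfaffian_subtype (horder.isNoncrossing_cogate hplane) Θ]
    refine Finset.prod_congr rfl fun c _ => ?_
    -- The complement, within a fibre, of the trace of `K` is the trace of `Kᶜ`.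
    congr 1
    ext e
    simp
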